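/- Let $P(x)=a_nx^n+\cdots+a_1x+a_0\in\mathbb{Z}[x]$ be a polynomial of degree $n\ge 2$ and let $q\ge 2$ be an integer satisfying $\gcd(a_n,\dots,a_0,q)=1$. Let $I\subset\mathbb{R}$ be a bounded interval of length $L$. Then the number $W$ of integers $x\in I$ with $P(x)\equiv 0\pmod q$ satisfies $$W\le 2(n-1)^2\,\omega(q)\left(\frac{L}{q^{1/n}}+1\right),$$ where $\omega(q)$ denotes the number of distinct prime divisors of $q$. -/

import Mathlib

/-- `I` is a bounded interval of the real line (closed, half-open or open) with endpoints at
distance `L`. -/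
def IsIntervalOfLength (I : Set ℝ) (L : ℝ) : Prop :=
  ∃ a b : ℝ, a ≤ b ∧ b - a = L ∧
    (I = Set.Icc a b ∨ I = Set.Ico a b ∨ I = Set.Ioc a b ∨ I = Set.Ioo a b)

/-- The integers `x` in `I` with `P(x) ≡ 0 (mod q)`. -/
def congruenceSolutions (P : Polynomial ℤ) (q : ℕ) (I : Set ℝ) : Set ℤ :=
  {x : ℤ | (x : ℝ) ∈ I ∧ P.eval x ≡ 0 [ZMOD (q : ℤ)]}

/-! It suffices to show that solutions within distance less than `q ^ (1 / n)` of each other number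
at most `n * ω(q)`; blocks of that length then cover the interval, and `n ≤ 2 (n - 1)^2`. Locally at
`p ^ a ∥ q`, a `p`-ordering of the solutions and Newton's formula give `n` nodes whose truncated
valuations at any solution add up to at least `a` (`exists_nodes`). Typing each solution by its
nearest node bounds valuations of differences below by a form `G` with `G ≥ a / n` times the squared
coordinate sum (`exists_types`). Given more than `n * ω(q)` solutions, linear algebra supplies `c ≠
0` with zero sum on each type at each prime, so `c⁺` and `c⁻` have the same type sums and the same
total `M`. Weighting `log |x - y|` by `c⁺ x * c⁻ y` and summing over primes yields at least `M ^ 2 *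
log q / n`, whereas the small diameter makes it strictly less. -/

/-! ### Truncated valuations -/

/-- The `p`-adic valuation of `z` truncated at `a`. -/
def truncVal (p a : ℕ) (z : ℤ) : ℕ :=
  ((Finset.range a).filter fun l => (p : ℤ) ^ (l + 1) ∣ z).card

theorem le_truncVal {p a k : ℕ} {z : ℤ} (hk : k ≤ a) (h : (p : ℤ) ^ k ∣ z) :
    k ≤ truncVal p a z := by
  rw [truncVal, ← Finset.card_range k]
  refine Finset.card_le_card fun l hl => ?_
  have hl := Finset.mem_range.1 hl
  exact Finset.mem_filter.2 ⟨Finset.mem_range.2 (by omega), (pow_dvd_pow _ (by omega)).trans h⟩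

theorem pow_truncVal_dvd (p a : ℕ) (z : ℤ) : (p : ℤ) ^ truncVal p a z ∣ z := by
  by_contra h
  have hsub : ((Finset.range a).filter fun l => (p : ℤ) ^ (l + 1) ∣ z) ⊆
      Finset.range (truncVal p a z - 1) := by
    intro l hl
    rw [Finset.mem_range]
    by_contra hlt
    exact h ((pow_dvd_pow _ (by omega)).trans (Finset.mem_filter.1 hl).2)
  have hcard := Finset.card_le_card hsub
  rw [Finset.card_range] at hcard
  change truncVal p a z ≤ _ at hcard
  have h0 : truncVal p a z = 0 := by omega
  rw [h0] at h
  simp at h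

theorem truncVal_le_factorization {p : ℕ} (hp : p.Prime) (a : ℕ) {z : ℤ} (hz : z ≠ 0) :
    truncVal p a z ≤ z.natAbs.factorization p := by
  rw [← hp.pow_dvd_iff_le_factorization (Int.natAbs_ne_zero.2 hz), ← Int.natCast_dvd]
  exact_mod_cast pow_truncVal_dvd p a z

theorem exists_add_eq_of_prime_pow_dvd_mul {p : ℕ} (hp : p.Prime) {k : ℕ} {y z : ℤ}
    (h : (p : ℤ) ^ k ∣ y * z) : ∃ i j, i + j = k ∧ (p : ℤ) ^ i ∣ y ∧ (p : ℤ) ^ j ∣ z := by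
  obtain ⟨u, v, hu, hv, huv⟩ := exists_dvd_and_dvd_of_dvd_mul h
  have hp' : Prime (p : ℤ) := Nat.prime_iff_prime_int.1 hp
  obtain ⟨i, hi, hui⟩ := (dvd_prime_pow hp' k).1 (Dvd.intro _ huv.symm)
  have hpi : (p : ℤ) ^ i ≠ 0 := pow_ne_zero _ hp'.ne_zero
  refine ⟨i, k - i, by omega, hui.symm.dvd.trans hu, ?_⟩
  refine dvd_trans ?_ hv
  rw [← mul_dvd_mul_iff_left hpi, ← pow_add, Nat.add_sub_cancel' hi, huv]
  exact mul_dvd_mul_right hui.dvd v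

theorem le_sum_truncVal {p : ℕ} (hp : p.Prime) {a : ℕ} {ι : Type*} (s : Finset ι) (z : ι → ℤ)
    {k : ℕ} (hk : k ≤ a) (h : (p : ℤ) ^ k ∣ ∏ j ∈ s, z j) :
    k ≤ ∑ j ∈ s, truncVal p a (z j) := by
  classical
  induction s using Finset.induction_on generalizing k with
  | empty =>
    have : k = 0 := by
      by_contra hk0
      have h1 := isUnit_of_dvd_one (by simpa using h)
      exact (Nat.prime_iff_prime_int.1 hp).not_isUnit ((isUnit_pow_iff hk0).1 h1)
    simp [this]
  | insert b s hb ih =>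
    rw [Finset.prod_insert hb] at h
    obtain ⟨i, j, hij, hi, hj⟩ := exists_add_eq_of_prime_pow_dvd_mul hp h
    rw [Finset.sum_insert hb, ← hij]
    exact add_le_add (le_truncVal (by omega) hi) (ih (by omega) hj)

theorem pow_sum_truncVal_dvd (p a : ℕ) {ι : Type*} (s : Finset ι) (z : ι → ℤ) :
    (p : ℤ) ^ (∑ j ∈ s, truncVal p a (z j)) ∣ ∏ j ∈ s, z j := by
  rw [← Finset.prod_pow_eq_pow_sum]
  exact Finset.prod_dvd_prod_of_dvd _ _ fun j _ => pow_truncVal_dvd p a (z j)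

/-! ### Newton expansion and `p`-orderings -/

/-- Newton's form of a polynomial with respect to arbitrary nodes. -/
theorem exists_newton_expansion (x : ℕ → ℤ) (n : ℕ) (P : Polynomial ℤ) (hP : P.natDegree ≤ n) :
    ∃ b : ℕ → ℤ, P = ∑ k ∈ Finset.range (n + 1),
      Polynomial.C (b k) * ∏ j ∈ Finset.range k, (Polynomial.X - Polynomial.C (x j)) := by
  induction n generalizing P with
  | zero =>
    refine ⟨fun _ => P.coeff 0, ?_⟩
    simpa using Polynomial.eq_C_of_natDegree_le_zero hP
  | succ n ih =>
    set e : Polynomial ℤ := ∏ j ∈ Finset.range (n + 1), (Polynomial.X - Polynomial.C (x j)) with he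
    have hmon : e.Monic := Polynomial.monic_prod_of_monic _ _ fun j _ => Polynomial.monic_X_sub_C _
    have hdeg : e.natDegree = n + 1 := by
      rw [he, Polynomial.natDegree_prod_of_monic _ _ fun j _ => Polynomial.monic_X_sub_C _]
      simp only [Polynomial.natDegree_X_sub_C]
      simp
    have hlow : (P - Polynomial.C (P.coeff (n + 1)) * e).natDegree ≤ n := by
      rw [Polynomial.natDegree_le_iff_coeff_eq_zero]
      intro N hN
      rcases Nat.lt_or_ge (n + 1) N with h | h
      · rw [Polynomial.coeff_sub, Polynomial.coeff_C_mul,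
          Polynomial.coeff_eq_zero_of_natDegree_lt (p := P) (n := N) (by omega),
          Polynomial.coeff_eq_zero_of_natDegree_lt (p := e) (n := N) (by omega)]
        simp
      · obtain rfl : N = n + 1 := by omega
        have : e.coeff (n + 1) = 1 := by rw [← hdeg]; exact hmon
        rw [Polynomial.coeff_sub, Polynomial.coeff_C_mul, this]
        simp
    obtain ⟨b, hb⟩ := ih _ hlow
    refine ⟨Function.update b (n + 1) (P.coeff (n + 1)), ?_⟩
    rw [Finset.sum_range_succ, Function.update_self, ← he]
    rw [Finset.sum_congr rfl (g := fun k => Polynomial.C (b k) *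
      ∏ j ∈ Finset.range k, (Polynomial.X - Polynomial.C (x j))), ← hb]
    · ring
    · intro k hk
      rw [Function.update_of_ne (by have := Finset.mem_range.1 hk; omega)]

/-- Existence of Bhargava's `p`-orderings, here for valuations truncated at `a`. -/
theorem exists_truncVal_ordering (p a : ℕ) (S : Finset ℤ) (hS : S.Nonempty) (n : ℕ) :
    ∃ x : ℕ → ℤ, ∀ k < n, x k ∈ S ∧ ∀ y ∈ S,
      ∑ j ∈ Finset.range k, truncVal p a (x k - x j) ≤
        ∑ j ∈ Finset.range k, truncVal p a (y - x j) := by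
  induction n with
  | zero => exact ⟨fun _ => 0, fun k hk => absurd hk (by omega)⟩
  | succ n ih =>
    obtain ⟨x, hx⟩ := ih
    obtain ⟨z, hz, hmin⟩ := S.exists_min_image
      (fun y => ∑ j ∈ Finset.range n, truncVal p a (y - x j)) hS
    refine ⟨Function.update x n z, fun k hk => ?_⟩
    have hsum : ∀ y : ℤ, ∑ j ∈ Finset.range k, truncVal p a (y - Function.update x n z j) =
        ∑ j ∈ Finset.range k, truncVal p a (y - x j) := fun y =>
      Finset.sum_congr rfl fun j hj => by
        rw [Function.update_of_ne (by have := Finset.mem_range.1 hj; omega)]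
    simp only [hsum]
    rcases Nat.lt_succ_iff_lt_or_eq.1 hk with h | rfl
    · rw [Function.update_of_ne (by omega)]
      exact hx k h
    · rw [Function.update_self]
      exact ⟨hz, hmin⟩

/-- The solutions of a primitive congruence of degree `n` modulo `p ^ a` are, up to truncation of
valuations at `a`, solutions of a congruence `∏ j, (y - r j) ≡ 0` with nodes among them. -/
theorem exists_nodes {p : ℕ} (hp : p.Prime) (a n : ℕ) (P : Polynomial ℤ) (hP : P.natDegree ≤ n)
    (hc : ¬ (p : ℤ) ∣ P.content) (S : Finset ℤ) (hS : S.Nonempty)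
    (hroot : ∀ y ∈ S, (p : ℤ) ^ a ∣ P.eval y) :
    ∃ r : Fin n → ℤ, (∀ j, r j ∈ S) ∧ ∀ y ∈ S, a ≤ ∑ j, truncVal p a (y - r j) := by
  -- The first `n` terms are the nodes; term `n` minimizes the sum to be bounded.
  obtain ⟨x, hx⟩ := exists_truncVal_ordering p a S hS (n + 1)
  refine ⟨fun j => x j, fun j => (hx j (by omega)).1, fun y hy => ?_⟩
  rw [Fin.sum_univ_eq_sum_range (fun j => truncVal p a (y - x j)) n]
  refine le_trans ?_ ((hx n (by omega)).2 y hy)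
  by_contra hlt
  push Not at hlt
  obtain ⟨b, hb⟩ := exists_newton_expansion x n P hP
  have heval : ∀ y, P.eval y =
      ∑ l ∈ Finset.range (n + 1), b l * ∏ j ∈ Finset.range l, (y - x j) := fun y => by
    conv_lhs => rw [hb]
    simp [Polynomial.eval_finsetSum, Polynomial.eval_prod]
  -- At `x k` the Newton terms beyond `k` vanish; those before are divisible by `p ^ a` by induction
  -- and minimality, which isolates term `k`.
  have key : ∀ k ≤ n, (p : ℤ) ^ a ∣
      b k * (p : ℤ) ^ (∑ j ∈ Finset.range k, truncVal p a (x k - x j)) := by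
    intro k
    induction k using Nat.strong_induction_on with
    | _ k ih =>
      intro hk
      have h1 := hroot _ (hx k (by omega)).1
      rw [heval, ← Finset.sum_subset (Finset.range_subset_range.2 (Nat.succ_le_succ hk)),
        Finset.sum_range_succ] at h1
      · have h2 : (p : ℤ) ^ a ∣
            ∑ l ∈ Finset.range k, b l * ∏ j ∈ Finset.range l, (x k - x j) := by
          refine Finset.dvd_sum fun l hl => ?_
          have hl := Finset.mem_range.1 hl
          refine (ih l hl (by omega)).trans (mul_dvd_mul_left _ ?_)
          exact (pow_dvd_pow _ ((hx l (by omega)).2 _ (hx k (by omega)).1)).trans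
            (pow_sum_truncVal_dvd p a _ _)
        obtain ⟨i, j, hij, hi, hj⟩ :=
          exists_add_eq_of_prime_pow_dvd_mul hp ((dvd_add_right h2).1 h1)
        rw [← hij, pow_add]
        exact mul_dvd_mul hi (pow_dvd_pow _ (le_sum_truncVal hp _ _ (by omega) hj))
      · intro l _ hl
        rw [Finset.prod_eq_zero (i := k), mul_zero]
        · simp only [Finset.mem_range] at hl ⊢; omega
        · simp
  have hdvd : ∀ k ≤ n, (p : ℤ) ∣ b k := by
    intro k hk
    -- Compare `x k` with `x n` by minimality. The exponent deficit forces `p` into every Newton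
    -- coefficient, against primitivity.
    have hν : ∑ j ∈ Finset.range k, truncVal p a (x k - x j) < a :=
      (((hx k (by omega)).2 _ (hx n (by omega)).1).trans
        (Finset.sum_le_sum_of_subset (Finset.range_subset_range.2 hk))).trans_lt hlt
    obtain ⟨d, hd⟩ := Nat.exists_eq_add_of_lt hν
    have h1 := key k hk
    have hpne : (p : ℤ) ^ (∑ j ∈ Finset.range k, truncVal p a (x k - x j)) ≠ 0 :=
      pow_ne_zero _ (by exact_mod_cast hp.ne_zero)
    conv at h1 => lhs; rw [hd, add_assoc, pow_add, mul_comm]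
    exact (dvd_pow_self _ (by omega)).trans ((mul_dvd_mul_iff_right hpne).1 h1)
  apply hc
  rw [Polynomial.dvd_content_iff_C_dvd, hb]
  refine Finset.dvd_sum fun k hk => dvd_mul_of_dvd_left (Polynomial.C_dvd_iff_dvd_coeff _ _ |>.2 ?_) _
  intro i
  rw [Polynomial.coeff_C]
  split_ifs
  · exact hdvd k (by have := Finset.mem_range.1 hk; omega)
  · exact dvd_zero _

/-! ### Positive semidefinite forms -/

/-- Each fibre of `f` contributes its common weight times the square of the sum of `D` over it. -/
theorem sum_fiber_mul_nonneg {ι α : Type*} [Fintype ι] [DecidableEq α] (f : ι → α) (w D : ι → ℝ)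
    (hw : ∀ i, 0 ≤ w i) (hf : ∀ i j, f i = f j → w i = w j) :
    0 ≤ ∑ i, ∑ j, (if f i = f j then w i else 0) * (D i * D j) := by
  classical
  rw [← Finset.sum_fiberwise_of_maps_to (t := Finset.univ.image f) (g := f)
    fun i _ => Finset.mem_image_of_mem f (Finset.mem_univ i)]
  refine Finset.sum_nonneg fun z hz => ?_
  obtain ⟨i₀, -, rfl⟩ := Finset.mem_image.1 hz
  have : ∑ i ∈ Finset.univ.filter (fun i => f i = f i₀),
      ∑ j, (if f i = f j then w i else 0) * (D i * D j) =
      w i₀ * (∑ i ∈ Finset.univ.filter (fun i => f i = f i₀), D i) ^ 2 := by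
    rw [sq, Finset.sum_mul_sum, Finset.mul_sum]
    refine Finset.sum_congr rfl fun i hi => ?_
    have hi := (Finset.mem_filter.1 hi).2
    rw [Finset.mul_sum, Finset.sum_filter]
    refine Finset.sum_congr rfl fun j _ => ?_
    rw [hi, hf i i₀ hi]
    by_cases h : f i₀ = f j
    · simp [h]
    · simp [h, Ne.symm h]
  rw [this]
  exact mul_nonneg (hw _) (sq_nonneg _)

/-- A positive semidefinite form with constant row sums `a` is at least `a / n` times the square
of the sum of the coordinates. -/
theorem sum_mul_ge_of_row_sum {n : ℕ} (hn : 0 < n) (G : Fin n → Fin n → ℝ) (a : ℝ)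
    (hsymm : ∀ i j, G i j = G j i) (hrow : ∀ i, ∑ j, G i j = a)
    (hpsd : ∀ D : Fin n → ℝ, 0 ≤ ∑ i, ∑ j, G i j * (D i * D j)) (C : Fin n → ℝ) :
    a / n * (∑ i, C i) ^ 2 ≤ ∑ i, ∑ j, G i j * (C i * C j) := by
  set m : ℝ := (∑ i, C i) / n with hm
  have hn' : (n : ℝ) ≠ 0 := by positivity
  have hsum : ∑ i, C i = n * m := by rw [hm]; field_simp
  -- Constant row sums make the all-ones vector an eigenvector, so only the deviation from the mean
  -- can be dropped.
  have h := hpsd fun i => C i - m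
  have e1 : ∑ i, ∑ j, G i j * (C i * m) = a * m * (n * m) := by
    rw [← hsum, Finset.mul_sum]
    refine Finset.sum_congr rfl fun i _ => ?_
    rw [← Finset.sum_mul, hrow]; ring
  have e2 : ∑ i, ∑ j, G i j * (m * C j) = a * m * (n * m) := by
    rw [Finset.sum_comm, ← e1]
    refine Finset.sum_congr rfl fun i _ => Finset.sum_congr rfl fun j _ => ?_
    rw [hsymm]; ring
  have e3 : ∑ i, ∑ j, G i j * (m * m) = a * m * (n * m) := by
    simp_rw [← Finset.sum_mul, hrow]
    simp; ring
  have e : ∑ i, ∑ j, G i j * ((C i - m) * (C j - m)) = ∑ i, ∑ j, G i j * (C i * C j) -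
      ∑ i, ∑ j, G i j * (C i * m) - ∑ i, ∑ j, G i j * (m * C j) +
      ∑ i, ∑ j, G i j * (m * m) := by
    simp only [← Finset.sum_sub_distrib, ← Finset.sum_add_distrib]
    refine Finset.sum_congr rfl fun i _ => Finset.sum_congr rfl fun j _ => ?_
    ring
  rw [e, e1, e2, e3] at h
  have e4 : a / n * (∑ i, C i) ^ 2 = a * m * (n * m) := by
    rw [hsum]; field_simp
  linarith

/-! ### Level weights -/

section Weights

variable {n : ℕ} (p a : ℕ) (r : Fin n → ℤ)

/-- The number of nodes congruent to `z` modulo `p ^ (l + 1)`. -/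
def nodeCount (l : ℕ) (z : ℤ) : ℕ :=
  (Finset.univ.filter fun j => (p : ℤ) ^ (l + 1) ∣ z - r j).card

/-- The number of pairs of a node and a level below `l` at which the node is congruent to `z`. -/
def cumulativeCount (l : ℕ) (z : ℤ) : ℕ := ∑ k ∈ Finset.range l, nodeCount p r k z

/-- The weight in `[0, 1]` of level `l` at `z`, chosen so that the weighted number of congruences
to the nodes is `a` whenever the unweighted one is at least `a`. -/
noncomputable def levelWeight (l : ℕ) (z : ℤ) : ℝ :=
  (((min a (cumulativeCount p r (l + 1) z) : ℕ) : ℝ) - ((min a (cumulativeCount p r l z) : ℕ) : ℝ)) /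
    (nodeCount p r l z : ℝ)

variable {p a r}

theorem nodeCount_congr {l : ℕ} {y z : ℤ} (h : (p : ℤ) ^ (l + 1) ∣ y - z) :
    nodeCount p r l y = nodeCount p r l z := by
  rw [nodeCount, nodeCount]
  congr 1
  refine Finset.filter_congr fun j _ => ?_
  rw [← sub_add_sub_cancel y z (r j), dvd_add_right h]

theorem cumulativeCount_congr {l : ℕ} {y z : ℤ} (h : (p : ℤ) ^ l ∣ y - z) :
    cumulativeCount p r l y = cumulativeCount p r l z :=
  Finset.sum_congr rfl fun k hk =>
    nodeCount_congr ((pow_dvd_pow _ (by have := Finset.mem_range.1 hk; omega)).trans h)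

theorem cumulativeCount_succ (l : ℕ) (z : ℤ) :
    cumulativeCount p r (l + 1) z = cumulativeCount p r l z + nodeCount p r l z :=
  Finset.sum_range_succ _ _

theorem cumulativeCount_mono {k l : ℕ} (h : k ≤ l) (z : ℤ) :
    cumulativeCount p r k z ≤ cumulativeCount p r l z :=
  Finset.sum_le_sum_of_subset (Finset.range_subset_range.2 h)

theorem cumulativeCount_eq_sum_truncVal (z : ℤ) :
    cumulativeCount p r a z = ∑ j, truncVal p a (z - r j) := by
  simp only [cumulativeCount, nodeCount, truncVal, Finset.card_filter]
  exact Finset.sum_comm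

theorem levelWeight_congr {l : ℕ} {y z : ℤ} (h : (p : ℤ) ^ (l + 1) ∣ y - z) :
    levelWeight p a r l y = levelWeight p a r l z := by
  rw [levelWeight, levelWeight, nodeCount_congr h, cumulativeCount_congr h,
    cumulativeCount_congr ((pow_dvd_pow _ (Nat.le_succ l)).trans h)]

theorem levelWeight_nonneg (l : ℕ) (z : ℤ) : 0 ≤ levelWeight p a r l z := by
  refine div_nonneg (sub_nonneg.2 ?_) (Nat.cast_nonneg _)
  exact_mod_cast min_le_min_left a (cumulativeCount_mono (Nat.le_succ l) z)

theorem levelWeight_le_one (l : ℕ) (z : ℤ) : levelWeight p a r l z ≤ 1 := by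
  refine div_le_one_of_le₀ ?_ (Nat.cast_nonneg _)
  rw [sub_le_iff_le_add]
  have := cumulativeCount_succ (p := p) (r := r) l z
  exact_mod_cast (by omega : min a (cumulativeCount p r (l + 1) z) ≤
    nodeCount p r l z + min a (cumulativeCount p r l z))

theorem levelWeight_mul_nodeCount (l : ℕ) (z : ℤ) :
    levelWeight p a r l z * nodeCount p r l z =
      ((min a (cumulativeCount p r (l + 1) z) : ℕ) : ℝ) -
        ((min a (cumulativeCount p r l z) : ℕ) : ℝ) := by
  rcases eq_or_ne (nodeCount p r l z) 0 with h | h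
  · rw [cumulativeCount_succ, h]
    simp
  · rw [levelWeight, div_mul_cancel₀]
    exact_mod_cast h

theorem sum_levelWeight_mul_nodeCount {z : ℤ} (hz : a ≤ ∑ j, truncVal p a (z - r j)) :
    ∑ l ∈ Finset.range a, levelWeight p a r l z * nodeCount p r l z = a := by
  simp_rw [levelWeight_mul_nodeCount]
  rw [Finset.sum_range_sub (fun l => ((min a (cumulativeCount p r l z) : ℕ) : ℝ)),
    cumulativeCount_eq_sum_truncVal, min_eq_left hz]
  simp [cumulativeCount]

/-- Past the level `t` where `z` leaves its nearest node, no node agrees with `z`, so the count up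
to `t` is already at least `a`. The node `r i` shares that count, hence `min a` is saturated there
and its later weights vanish. -/
theorem dvd_sub_of_levelWeight_ne_zero {l : ℕ} (hl : l < a) {z : ℤ} {i : Fin n}
    (hi : ∀ j, truncVal p a (z - r j) ≤ truncVal p a (z - r i))
    (hz : a ≤ ∑ j, truncVal p a (z - r j)) (hw : levelWeight p a r l (r i) ≠ 0) :
    (p : ℤ) ^ (l + 1) ∣ z - r i := by
  by_contra hnd
  apply hw
  set t := truncVal p a (z - r i) with ht
  have hdvd : (p : ℤ) ^ t ∣ z - r i := pow_truncVal_dvd p a _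
  have htl : t ≤ l := by
    by_contra h
    exact hnd ((pow_dvd_pow _ (by omega)).trans hdvd)
  have hzero : ∀ k ∈ Finset.range a, k ∉ Finset.range t → nodeCount p r k z = 0 := by
    intro k hk hkt
    rw [Finset.mem_range] at hk hkt
    rw [nodeCount, Finset.card_eq_zero, Finset.filter_eq_empty_iff]
    intro j _ hj
    have := (le_truncVal (by omega) hj).trans (hi j)
    omega
  have h1 : cumulativeCount p r t z = cumulativeCount p r a z :=
    Finset.sum_subset (Finset.range_subset_range.2 (by omega)) hzero
  rw [cumulativeCount_congr hdvd, cumulativeCount_eq_sum_truncVal (a := a)] at h1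
  have h2 := cumulativeCount_mono (p := p) (r := r) htl (r i)
  have h3 := cumulativeCount_mono (p := p) (r := r) (show l ≤ l + 1 by omega) (r i)
  rw [levelWeight, min_eq_left (by omega), min_eq_left (by omega), sub_self, zero_div]

end Weights

/-! ### The local quadratic form -/

/-- The solutions of a primitive congruence of degree `n` modulo `p ^ a` fall into `n` types such
that the valuation of a difference of solutions is bounded below, in terms of their types, by a
quadratic form which is at least `a / n` times the square of the sum of the coordinates. -/
theorem exists_types {p : ℕ} (hp : p.Prime) (a n : ℕ) (hn : 0 < n) (P : Polynomial ℤ)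
    (hP : P.natDegree ≤ n) (hc : ¬ (p : ℤ) ∣ P.content) (S : Finset ℤ) (hS : S.Nonempty)
    (hroot : ∀ y ∈ S, (p : ℤ) ^ a ∣ P.eval y) :
    ∃ (τ : ℤ → Fin n) (G : Fin n → Fin n → ℝ),
      (∀ x ∈ S, ∀ y ∈ S, G (τ x) (τ y) ≤ truncVal p a (x - y)) ∧
      ∀ C : Fin n → ℝ, (a : ℝ) / n * (∑ i, C i) ^ 2 ≤ ∑ i, ∑ j, G i j * (C i * C j) := by
  obtain ⟨r, hrS, hr⟩ := exists_nodes hp a n P hP hc S hS hroot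
  have : Nonempty (Fin n) := ⟨⟨0, hn⟩⟩
  choose τ hτ using fun z : ℤ => Finite.exists_max fun j => truncVal p a (z - r j)
  refine ⟨τ, fun i j => ∑ l ∈ Finset.range a,
    if (p : ℤ) ^ (l + 1) ∣ r i - r j then levelWeight p a r l (r i) else 0, ?_,
    sum_mul_ge_of_row_sum hn _ a ?_ ?_ ?_⟩
  · intro x hx y hy
    rw [truncVal, Finset.card_filter]
    push_cast
    refine Finset.sum_le_sum fun l hl => ?_
    have hl := Finset.mem_range.1 hl
    by_cases hd : (p : ℤ) ^ (l + 1) ∣ r (τ x) - r (τ y)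
    · rw [if_pos hd]
      by_cases hw : levelWeight p a r l (r (τ x)) = 0
      · rw [hw]; positivity
      · have h1 := dvd_sub_of_levelWeight_ne_zero hl (hτ x) (hr x hx) hw
        have h2 := dvd_sub_of_levelWeight_ne_zero hl (hτ y) (hr y hy)
          (by rwa [← levelWeight_congr hd])
        rw [if_pos]
        · exact levelWeight_le_one _ _
        -- Ultrametric chain from `x` through both nodes to `y`.
        · have := (h1.add hd).sub h2
          ring_nf at this ⊢
          exact this
    · rw [if_neg hd]; positivity
  · intro i j
    refine Finset.sum_congr rfl fun l _ => ?_
    simp only [dvd_sub_comm (b := r j)]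
    split_ifs with h
    · exact levelWeight_congr h
    · rfl
  · intro i
    rw [Finset.sum_comm, ← sum_levelWeight_mul_nodeCount (hr _ (hrS i))]
    refine Finset.sum_congr rfl fun l _ => ?_
    rw [← Finset.sum_filter, Finset.sum_const, nodeCount, nsmul_eq_mul, mul_comm]
  · intro D
    have h : ∀ l ∈ Finset.range a, 0 ≤ ∑ i, ∑ j, (if (p : ℤ) ^ (l + 1) ∣ r i - r j then
        levelWeight p a r l (r i) else 0) * (D i * D j) := by
      intro l _
      have hiff : ∀ y z : ℤ, (p : ℤ) ^ (l + 1) ∣ y - z ↔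
          y % (p : ℤ) ^ (l + 1) = z % (p : ℤ) ^ (l + 1) := fun y z =>
        (Int.modEq_iff_dvd.symm).trans ⟨Eq.symm, Eq.symm⟩
      simp_rw [hiff]
      exact sum_fiber_mul_nonneg _ _ D (fun i => levelWeight_nonneg _ _)
        fun i j hij => levelWeight_congr ((hiff _ _).2 hij)
    refine (Finset.sum_nonneg h).trans_eq ?_
    rw [Finset.sum_comm]
    refine Finset.sum_congr rfl fun i _ => ?_
    rw [Finset.sum_comm]
    refine Finset.sum_congr rfl fun j _ => ?_
    rw [Finset.sum_mul]

/-! ### Balanced weights and the global bound -/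

/-- More than `n * ω` points, each of which has one of `n` types at each of `ω` places, carry a
nontrivial weight whose sum over each type at each place vanishes. -/
theorem exists_balanced_weight {κ : Type*} [Fintype κ] {n : ℕ} (S : Finset ℤ)
    (τ : κ → ℤ → Fin n) (hcard : Fintype.card κ * n < S.card) :
    ∃ c : ℤ → ℝ, (∃ x ∈ S, c x ≠ 0) ∧
      ∀ k i, ∑ x ∈ S with τ k x = i, c x = 0 := by
  classical
  let F : (S → ℝ) →ₗ[ℝ] (κ × Fin n → ℝ) :=
    { toFun := fun c ki => ∑ x : S, if τ ki.1 x = ki.2 then c x else 0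
      map_add' := fun c d => by
        ext ki
        simp only [Pi.add_apply, ← Finset.sum_add_distrib]
        refine Finset.sum_congr rfl fun x _ => ?_
        split_ifs <;> simp
      map_smul' := fun m c => by
        ext ki
        simp [Finset.mul_sum] }
  have hker : LinearMap.ker F ≠ ⊥ := by
    apply LinearMap.ker_ne_bot_of_finrank_lt
    simpa using hcard
  obtain ⟨c, hc, hc0⟩ := (Submodule.ne_bot_iff _).1 hker
  obtain ⟨x, hx⟩ := Function.ne_iff.1 hc0
  refine ⟨fun z => if h : z ∈ S then c ⟨z, h⟩ else 0, ⟨x, x.2, by simpa using hx⟩, fun k i => ?_⟩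
  have h := congrFun (LinearMap.mem_ker.1 hc) (k, i)
  rw [Finset.sum_filter, ← Finset.sum_coe_sort S]
  simpa [F] using h

/-- A kernel depending only on types sees only type sums, so `c⁻` can be traded for `c⁺`. -/
theorem sum_types_mul {n : ℕ} (S : Finset ℤ) (τ : ℤ → Fin n) (G : Fin n → Fin n → ℝ)
    (u v : ℤ → ℝ) :
    ∑ x ∈ S, ∑ y ∈ S, u x * v y * G (τ x) (τ y) =
      ∑ i, ∑ j, G i j * ((∑ x ∈ S with τ x = i, u x) * ∑ y ∈ S with τ y = j, v y) := by
  have h1 : ∀ x, ∑ y ∈ S, u x * v y * G (τ x) (τ y) =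
      ∑ j, u x * G (τ x) j * ∑ y ∈ S with τ y = j, v y := fun x => by
    rw [← Finset.sum_fiberwise S τ]
    refine Finset.sum_congr rfl fun j _ => ?_
    rw [Finset.mul_sum]
    refine Finset.sum_congr rfl fun y hy => ?_
    rw [(Finset.mem_filter.1 hy).2]; ring
  simp_rw [h1]
  rw [← Finset.sum_fiberwise S τ]
  refine Finset.sum_congr rfl fun i _ => ?_
  rw [Finset.sum_comm]
  refine Finset.sum_congr rfl fun j _ => ?_
  rw [Finset.sum_mul, Finset.mul_sum]
  refine Finset.sum_congr rfl fun x hx => ?_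
  rw [(Finset.mem_filter.1 hx).2]; ring

/-- Pairwise coprime prime powers dividing `z` have product at most `|z|`. -/
theorem sum_log_mul_truncVal_le (q : ℕ) (a : ℕ → ℕ) {z : ℤ} (hz : z ≠ 0) :
    ∑ p ∈ q.primeFactors, Real.log p * truncVal p (a p) z ≤ Real.log |(z : ℝ)| := by
  have hz' := Int.natAbs_ne_zero.2 hz
  have hdvd : ∏ p ∈ q.primeFactors, p ^ truncVal p (a p) z ∣ z.natAbs := by
    refine Finset.prod_dvd_of_isRelPrime ?_ ?_
    · intro p hp p' hp' hne
      rw [Function.onFun, ← Nat.coprime_iff_isRelPrime]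
      exact Nat.coprime_pow_primes _ _ (Nat.prime_of_mem_primeFactors hp)
        (Nat.prime_of_mem_primeFactors hp') hne
    · intro p _
      rw [← Int.natCast_dvd]
      exact_mod_cast pow_truncVal_dvd p (a p) z
  have hle := Nat.le_of_dvd (Nat.pos_of_ne_zero hz') hdvd
  have hpos : ∀ p ∈ q.primeFactors, (p : ℝ) ≠ 0 := fun p hp => by
    exact_mod_cast (Nat.prime_of_mem_primeFactors hp).ne_zero
  have h1 : ∑ p ∈ q.primeFactors, Real.log p * truncVal p (a p) z =
      Real.log ((∏ p ∈ q.primeFactors, p ^ truncVal p (a p) z : ℕ) : ℝ) := by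
    push_cast
    rw [Real.log_prod fun p hp => pow_ne_zero _ (hpos p hp)]
    refine Finset.sum_congr rfl fun p _ => ?_
    rw [Real.log_pow, mul_comm]
  rw [h1, ← Int.cast_abs, ← Nat.cast_natAbs]
  refine Real.log_le_log ?_ ?_
  · exact_mod_cast Finset.prod_pos fun p hp =>
      pow_pos (Nat.prime_of_mem_primeFactors hp).pos _
  · simpa using (Nat.cast_le (α := ℝ)).2 hle

theorem log_eq_sum_factorization {q : ℕ} (hq : q ≠ 0) :
    Real.log q = ∑ p ∈ q.primeFactors, Real.log p * q.factorization p := by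
  conv_lhs => rw [← Nat.prod_factorization_pow_eq_self hq]
  rw [Finsupp.prod, Nat.support_factorization]
  push_cast
  rw [Real.log_prod fun p hp =>
    pow_ne_zero _ (by exact_mod_cast (Nat.prime_of_mem_primeFactors hp).ne_zero)]
  refine Finset.sum_congr rfl fun p _ => ?_
  rw [Real.log_pow, mul_comm]

/-- A primitive congruence of degree `n` modulo `q` has at most `n * ω(q)` solutions in a set of
diameter less than `q ^ (1 / n)`. -/
theorem card_solutions_le_of_diam_lt (P : Polynomial ℤ) (n : ℕ) (hn : 0 < n)
    (hP : P.natDegree ≤ n) (q : ℕ) (hq : 2 ≤ q) (hgcd : Int.gcd P.content (q : ℤ) = 1)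
    (S : Finset ℤ) (hroot : ∀ x ∈ S, (q : ℤ) ∣ P.eval x)
    (hdiam : ∀ x ∈ S, ∀ y ∈ S, |((x - y : ℤ) : ℝ)| < (q : ℝ) ^ ((1 : ℝ) / (n : ℝ))) :
    S.card ≤ q.primeFactors.card * n := by
  by_contra hcard
  push Not at hcard
  have hq0 : q ≠ 0 := by omega
  have hS : S.Nonempty := Finset.card_pos.1 (by omega)
  have hloc : ∀ p : q.primeFactors, ∃ (τ : ℤ → Fin n) (G : Fin n → Fin n → ℝ),
      (∀ x ∈ S, ∀ y ∈ S, G (τ x) (τ y) ≤ truncVal p (q.factorization p) (x - y)) ∧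
      ∀ C : Fin n → ℝ, (q.factorization p : ℝ) / n * (∑ i, C i) ^ 2 ≤
        ∑ i, ∑ j, G i j * (C i * C j) := by
    intro p
    have hp := Nat.prime_of_mem_primeFactors p.2
    refine exists_types hp _ n hn P hP ?_ S hS fun x hx => ?_
    · intro h
      have h1 := Int.dvd_coe_gcd h (Int.natCast_dvd_natCast.2 (Nat.dvd_of_mem_primeFactors p.2))
      rw [hgcd] at h1
      exact hp.one_lt.ne' (by exact_mod_cast Int.eq_one_of_dvd_one (by positivity) h1)
    · refine dvd_trans ?_ (hroot x hx)
      exact_mod_cast Nat.ordProj_dvd q p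
  choose τ G hG hform using hloc
  obtain ⟨c, ⟨x₀, hx₀, hcx₀⟩, hc⟩ := exists_balanced_weight S τ (by simpa using hcard)
  have hbal : ∀ p i, ∑ x ∈ S with τ p x = i, (c x)⁻ = ∑ x ∈ S with τ p x = i, (c x)⁺ := by
    intro p i
    rw [eq_comm, ← sub_eq_zero, ← Finset.sum_sub_distrib, ← hc p i]
    exact Finset.sum_congr rfl fun x _ => posPart_sub_negPart _
  have hfib : ∀ p, ∑ i, ∑ x ∈ S with τ p x = i, (c x)⁺ = ∑ x ∈ S, (c x)⁺ := fun p =>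
    Finset.sum_fiberwise S (τ p) _
  set M := ∑ x ∈ S, (c x)⁺ with hM
  obtain ⟨p₀, hp₀⟩ : q.primeFactors.Nonempty := Nat.nonempty_primeFactors.2 (by omega)
  have hMneg : ∑ x ∈ S, (c x)⁻ = M := by
    rw [← hfib ⟨p₀, hp₀⟩, ← Finset.sum_fiberwise S (τ ⟨p₀, hp₀⟩)]
    exact Finset.sum_congr rfl fun i _ => hbal _ i
  have hMpos : 0 < M := by
    rcases lt_or_gt_of_ne hcx₀ with h | h
    · rw [← hMneg]
      exact Finset.sum_pos' (fun x _ => negPart_nonneg _) ⟨x₀, hx₀, negPart_pos h⟩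
    · exact Finset.sum_pos' (fun x _ => posPart_nonneg _) ⟨x₀, hx₀, posPart_pos h⟩
  -- Removes the diagonal, where `Real.log 0 = 0` while the truncated valuation of `0` is positive.
  have hdisj : ∀ x, (c x)⁺ * (c x)⁻ = 0 := fun x => by
    rcases le_total (c x) 0 with h | h
    · rw [posPart_eq_zero.2 h, zero_mul]
    · rw [negPart_eq_zero.2 h, mul_zero]
  have hlog_n : ∀ x ∈ S, ∀ y ∈ S, x ≠ y →
      Real.log |((x - y : ℤ) : ℝ)| < Real.log q / n := fun x hx y hy hxy => by
    have h := Real.log_lt_log (abs_pos.2 (by exact_mod_cast sub_ne_zero.2 hxy)) (hdiam x hx y hy)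
    rwa [Real.log_rpow (by positivity), one_div_mul_eq_div] at h
  have hupper : ∑ x ∈ S, ∑ y ∈ S, (c x)⁺ * (c y)⁻ * Real.log |((x - y : ℤ) : ℝ)| <
      Real.log q / n * M ^ 2 := by
    have hR : Real.log q / n * M ^ 2 = ∑ x ∈ S, ∑ y ∈ S, (c x)⁺ * (c y)⁻ * (Real.log q / n) := by
      simp_rw [← Finset.sum_mul, ← Finset.mul_sum, hMneg, ← Finset.sum_mul]
      ring
    have hle : ∀ x ∈ S, ∀ y ∈ S, (c x)⁺ * (c y)⁻ * Real.log |((x - y : ℤ) : ℝ)| ≤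
        (c x)⁺ * (c y)⁻ * (Real.log q / n) := fun x hx y hy => by
      rcases eq_or_ne x y with rfl | hxy
      · rw [hdisj]; simp
      · exact mul_le_mul_of_nonneg_left (hlog_n x hx y hy hxy).le
          (mul_nonneg (posPart_nonneg _) (negPart_nonneg _))
    obtain ⟨x, hx, hcx⟩ : ∃ x ∈ S, 0 < (c x)⁺ := by
      by_contra! h
      exact hMpos.not_ge (Finset.sum_nonpos h)
    obtain ⟨y, hy, hcy⟩ : ∃ y ∈ S, 0 < (c y)⁻ := by
      by_contra! h
      exact hMpos.not_ge (hMneg ▸ Finset.sum_nonpos h)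
    have hxy : x ≠ y := by
      rintro rfl
      exact (mul_pos hcx hcy).ne' (hdisj x)
    rw [hR]
    refine Finset.sum_lt_sum (fun x hx => Finset.sum_le_sum fun y hy => hle x hx y hy)
      ⟨x, hx, Finset.sum_lt_sum (fun y hy => hle x hx y hy) ⟨y, hy, ?_⟩⟩
    exact mul_lt_mul_of_pos_left (hlog_n x hx y hy hxy) (mul_pos hcx hcy)
  have hlower : Real.log q / n * M ^ 2 ≤
      ∑ x ∈ S, ∑ y ∈ S, (c x)⁺ * (c y)⁻ * Real.log |((x - y : ℤ) : ℝ)| := by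
    calc Real.log q / n * M ^ 2
        = ∑ p : q.primeFactors, Real.log p * ((q.factorization p : ℝ) / n * M ^ 2) := by
          rw [log_eq_sum_factorization hq0, ← Finset.sum_coe_sort, Finset.sum_div, Finset.sum_mul]
          exact Finset.sum_congr rfl fun p _ => by ring
      _ ≤ ∑ p : q.primeFactors, Real.log p *
            ∑ x ∈ S, ∑ y ∈ S, (c x)⁺ * (c y)⁻ * G p (τ p x) (τ p y) := by
          refine Finset.sum_le_sum fun p _ =>
            mul_le_mul_of_nonneg_left ?_ (Real.log_natCast_nonneg _)
          rw [sum_types_mul]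
          simp_rw [hbal]
          rw [← hfib p]
          exact hform p _
      _ ≤ ∑ p : q.primeFactors, Real.log p *
            ∑ x ∈ S, ∑ y ∈ S, (c x)⁺ * (c y)⁻ * truncVal p (q.factorization p) (x - y) := by
          refine Finset.sum_le_sum fun p _ =>
            mul_le_mul_of_nonneg_left ?_ (Real.log_natCast_nonneg _)
          exact Finset.sum_le_sum fun x hx => Finset.sum_le_sum fun y hy =>
            mul_le_mul_of_nonneg_left (hG p x hx y hy)
              (mul_nonneg (posPart_nonneg _) (negPart_nonneg _))
      _ = ∑ x ∈ S, ∑ y ∈ S, (c x)⁺ * (c y)⁻ *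
            ∑ p ∈ q.primeFactors, Real.log p * truncVal p (q.factorization p) (x - y) := by
          simp_rw [Finset.mul_sum]
          rw [Finset.sum_coe_sort q.primeFactors fun p => ∑ x ∈ S, ∑ y ∈ S,
            Real.log p * ((c x)⁺ * (c y)⁻ * truncVal p (q.factorization p) (x - y)),
            Finset.sum_comm]
          refine Finset.sum_congr rfl fun x _ => ?_
          rw [Finset.sum_comm]
          exact Finset.sum_congr rfl fun y _ => Finset.sum_congr rfl fun p _ => by ring
      _ ≤ _ := by
          refine Finset.sum_le_sum fun x _ => Finset.sum_le_sum fun y _ => ?_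
          rcases eq_or_ne x y with rfl | hxy
          · rw [hdisj]; simp
          · exact mul_le_mul_of_nonneg_left (sum_log_mul_truncVal_le _ _ (sub_ne_zero.2 hxy))
              (mul_nonneg (posPart_nonneg _) (negPart_nonneg _))
  exact hlower.not_gt hupper

/-! ### Covering the interval -/

/-- If `S` meets each half-open interval of length `w` in at most `K` points, then it has at most
`K * (L / w + 1)` points in a closed interval of length `L`. -/
theorem card_le_of_card_Ico_le (S : Finset ℤ) (α L w : ℝ) (hw : 0 < w) (hL : 0 ≤ L) (K : ℕ)
    (hS : ∀ x ∈ S, (x : ℝ) ∈ Set.Icc α (α + L))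
    (hK : ∀ T ⊆ S, (∀ x ∈ T, ∀ y ∈ T, |((x - y : ℤ) : ℝ)| < w) → T.card ≤ K) :
    (S.card : ℝ) ≤ K * (L / w + 1) := by
  have hmaps : ∀ x ∈ S, ⌊((x : ℝ) - α) / w⌋₊ ∈ Finset.range (⌊L / w⌋₊ + 1) := by
    intro x hx
    rw [Finset.mem_range, Nat.lt_succ_iff]
    refine Nat.floor_le_floor ?_
    have := (hS x hx).2
    gcongr
    linarith
  have h := Finset.card_le_mul_card_image_of_maps_to hmaps K fun k _ => by
    refine hK _ (Finset.filter_subset _ _) fun x hx y hy => ?_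
    rw [Finset.mem_filter] at hx hy
    have hb : ∀ z ∈ S, ⌊((z : ℝ) - α) / w⌋₊ = k → k * w ≤ z - α ∧ z - α < (k + 1) * w := by
      intro z hz hzk
      have h0 : 0 ≤ ((z : ℝ) - α) / w := div_nonneg (sub_nonneg.2 (hS z hz).1) hw.le
      have := (Nat.floor_eq_iff h0).1 hzk
      exact ⟨(le_div_iff₀ hw).1 this.1, (div_lt_iff₀ hw).1 this.2⟩
    have h1 := hb x hx.1 hx.2
    have h2 := hb y hy.1 hy.2
    rw [abs_lt]
    push_cast
    constructor <;> linarith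
  rw [Finset.card_range] at h
  calc (S.card : ℝ) ≤ K * (⌊L / w⌋₊ + 1) := by exact_mod_cast h
    _ ≤ K * (L / w + 1) := by
      gcongr
      exact Nat.floor_le (by positivity)

theorem corollary2 (P : Polynomial ℤ) (n : ℕ) (hn : 2 ≤ n) (hP : P.natDegree = n)
    (q : ℕ) (hq : 2 ≤ q) (hgcd : Int.gcd P.content (q : ℤ) = 1)
    (I : Set ℝ) (L : ℝ) (hI : IsIntervalOfLength I L) :
    (congruenceSolutions P q I).Finite ∧
      ((congruenceSolutions P q I).ncard : ℝ) ≤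
        2 * ((n : ℝ) - 1) ^ 2 * (ArithmeticFunction.cardDistinctFactors q : ℝ) *
          (L / (q : ℝ) ^ ((1 : ℝ) / (n : ℝ)) + 1) := by
  obtain ⟨α, β, hαβ, rfl, hI⟩ := hI
  have hsub : I ⊆ Set.Icc α β := by
    rcases hI with rfl | rfl | rfl | rfl
    exacts [subset_rfl, Set.Ico_subset_Icc_self, Set.Ioc_subset_Icc_self, Set.Ioo_subset_Icc_self]
  have hfin : (congruenceSolutions P q I).Finite := by
    refine (Set.finite_Icc ⌈α⌉ ⌊β⌋).subset fun x hx => ?_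
    exact ⟨Int.ceil_le.2 (hsub hx.1).1, Int.le_floor.2 (hsub hx.1).2⟩
  refine ⟨hfin, ?_⟩
  have hq' : (0 : ℝ) < q := by positivity
  have hw : (0 : ℝ) < (q : ℝ) ^ ((1 : ℝ) / (n : ℝ)) := Real.rpow_pos_of_pos hq' _
  have hbound := card_le_of_card_Ico_le hfin.toFinset α (β - α) _ hw (sub_nonneg.2 hαβ)
    (q.primeFactors.card * n)
    (fun x hx => by
      rw [add_sub_cancel]
      exact hsub ((hfin.mem_toFinset.1 hx).1))
    (fun T hT hdiam => card_solutions_le_of_diam_lt P n (by omega) hP.le q hq hgcd T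
      (fun x hx => Int.modEq_zero_iff_dvd.1 (hfin.mem_toFinset.1 (hT hx)).2) hdiam)
  rw [Set.ncard_eq_toFinset_card _ hfin]
  refine hbound.trans ?_
  have hω : ArithmeticFunction.cardDistinctFactors q = q.primeFactors.card := by
    rw [ArithmeticFunction.cardDistinctFactors_apply]; rfl
  have hn' : (2 : ℝ) ≤ n := by exact_mod_cast hn
  rw [hω]
  push_cast
  refine mul_le_mul_of_nonneg_right ?_ ?_
  -- `2 (n - 1)^2 - n = (2 n - 1)(n - 2)` is nonnegative for `n ≥ 2`.
  · rw [mul_comm]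
    exact mul_le_mul_of_nonneg_right (by nlinarith) (Nat.cast_nonneg _)
  · have := sub_nonneg.2 hαβ
    positivity
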